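/- Let $n\ge 1$ be a natural number and let $\mathbb B_n=\{0,\dots,n-1\}\times\mathbb Q$ be the disjoint union of $n$ copies of the rational line, partially ordered by $\langle i_1,q_1\rangle<\langle i_2,q_2\rangle$ iff $i_1=i_2$ and $q_1<q_2$. Let $\mathbb P(\mathbb B_n)$ denote the set of all subsets $A\subset\mathbb B_n$ which, with the induced order, are isomorphic to $\mathbb B_n$. Let $L$ be a complete linear order (it has a least element $0_L$ and a greatest element, and has no gaps; equivalently, every subset of $L$ has a supremum and an infimum) which embeds into the real line $\langle\mathbb R,<\rangle$ and whose least element $0_L$ is non-isolated, that is, $0_L$ is an accumulation point of $L\setminus\{0_L\}$ in the order topology. Then there is a maximal chain in the poset $\langle\mathbb P(\mathbb B_n)\cup\{\emptyset\},\subset\rangle$ which, ordered by inclusion, is isomorphic to $L$. -/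

import Mathlib

/-- `𝔹 n`: the disjoint union of `n` copies of the rational line. The order is Mathlib's disjoint sum
of orders: `⟨i, p⟩ < ⟨j, q⟩` iff `i = j` and `p < q`. -/
abbrev DisjointRationals (n : ℕ) : Type := Σ _ : Fin n, ℚ

/-- The set `ℙ(X)` of copies of a partial order `X` inside itself: the subsets of `X` which, with
the induced order, are isomorphic to `X`. -/
def copies (X : Type*) [PartialOrder X] : Set (Set X) :=
  {A | Nonempty (A ≃o X)}

/-- The poset `⟨ℙ(X) ∪ {∅}, ⊂⟩`, ordered by inclusion. -/
abbrev CopiesPoset (X : Type*) [PartialOrder X] : Type _ :=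
  ↥(copies X ∪ {∅} : Set (Set X))

/-- A linear order embeds into the real line. -/
def RealEmbeddable (L : Type*) [LinearOrder L] : Prop :=
  Nonempty (L ↪o ℝ)

/-- The least element of a linear order is not an isolated point of the order topology: it is an
accumulation point of the set of the other elements. -/
def BotNonIsolated (L : Type*) [LinearOrder L] [OrderBot L] : Prop :=
  letI : TopologicalSpace L := Preorder.topology L
  (nhdsWithin (⊥ : L) {⊥}ᶜ).NeBot

/-! Assign to each point of `𝔹 n` a birth time in `L`. The sets of points born strictly before `x`
form a chain, isomorphic to `L` once every `[x, y)` contains a birth time, and its nonempty members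
are copies if their components are endless dense. The chain is maximal
(`exists_isMaxChain_of_sublevel`) if each point is either the only one born at its time, which has
an immediate successor, or greatest in its component among those born by then: a copy has no maximal
element, so no copy can stop at a point of the second kind. `exists_isMaxChain_of_placement` builds
such times: jump-free parts of `L` are filled in increasing order, while each jump adds one point to
the left of what is already there. Jump-free parts or jumps accumulate at `⊥`, and each case has its
own placement. -/

/-- A nonempty set of points of a linear order which has neither a least nor a greatest element
and is densely ordered. -/
def EndlessDense {α : Type*} [LinearOrder α] (s : Set α) : Prop :=
  s.Nonempty ∧ (∀ a ∈ s, ∃ b ∈ s, a < b) ∧ (∀ a ∈ s, ∃ b ∈ s, b < a) ∧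
    ∀ a ∈ s, ∀ b ∈ s, a < b → ∃ c ∈ s, a < c ∧ c < b

/-- The elements of an order which have an immediate successor. -/
def jumpSet (L : Type*) [Preorder L] : Set L := {x | ∃ y, x ⋖ y}

theorem EndlessDense.nonempty_orderIso_rat {α : Type*} [LinearOrder α] {s : Set α}
    (hs : EndlessDense s) (hc : s.Countable) : Nonempty (s ≃o ℚ) := by
  obtain ⟨hne, hmax, hmin, hd⟩ := hs
  have : Countable s := hc.to_subtype
  have : Nonempty s := hne.to_subtype
  have : NoMaxOrder s := ⟨fun a => by
    obtain ⟨b, hb, h⟩ := hmax a a.2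
    exact ⟨⟨b, hb⟩, h⟩⟩
  have : NoMinOrder s := ⟨fun a => by
    obtain ⟨b, hb, h⟩ := hmin a a.2
    exact ⟨⟨b, hb⟩, h⟩⟩
  have : DenselyOrdered s := ⟨fun a b hab => by
    obtain ⟨c, hc, h1, h2⟩ := hd a a.2 b b.2 hab
    exact ⟨⟨c, hc⟩, h1, h2⟩⟩
  exact Order.iso_of_countable_dense s ℚ

theorem EndlessDense.preimage_orderIso {α β : Type*} [LinearOrder α] [LinearOrder β]
    {s t : Set α} (e : β ≃o t) (hst : s ⊆ t) (hs : EndlessDense s) :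
    EndlessDense {b : β | (e b : α) ∈ s} := by
  obtain ⟨⟨a, ha⟩, hmax, hmin, hd⟩ := hs
  refine ⟨⟨e.symm ⟨a, hst ha⟩, by simpa using ha⟩, fun b hb => ?_, fun b hb => ?_,
    fun b hb c hc hbc => ?_⟩
  · obtain ⟨c, hc, h⟩ := hmax _ hb
    exact ⟨e.symm ⟨c, hst hc⟩, by simpa using hc, e.lt_symm_apply.2 h⟩
  · obtain ⟨c, hc, h⟩ := hmin _ hb
    exact ⟨e.symm ⟨c, hst hc⟩, by simpa using hc, e.symm_apply_lt.2 h⟩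
  · obtain ⟨d, hd, h1, h2⟩ := hd _ hb _ hc (e.lt_iff_lt.2 hbc)
    exact ⟨e.symm ⟨d, hst hd⟩, by simpa using hd, e.lt_symm_apply.2 h1, e.symm_apply_lt.2 h2⟩

/-- Countably many infinite sets have an injective choice function. -/
theorem exists_injective_choice {ι α : Type*} [Countable ι] (A : ι → Set α)
    (hA : ∀ i, (A i).Infinite) : ∃ f : ι → α, Function.Injective f ∧ ∀ i, f i ∈ A i := by
  classical
  obtain ⟨c, hc⟩ := exists_injective_nat ι
  -- With `c i + 1` elements in the `i`-th set, the largest code in a finite family bounds the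
  -- family's size, which is Hall's condition.
  choose t ht htc using fun i => (hA i).exists_subset_card_eq (c i + 1)
  have hall : ∀ s : Finset ι, s.card ≤ (s.biUnion t).card := by
    intro s
    rcases s.eq_empty_or_nonempty with rfl | hs
    · simp
    obtain ⟨m, hm, hmax⟩ := s.exists_max_image c hs
    calc s.card = (s.image c).card := (Finset.card_image_of_injective s hc).symm
      _ ≤ (Finset.range (c m + 1)).card := Finset.card_le_card fun k hk => by
          obtain ⟨i, hi, rfl⟩ := Finset.mem_image.1 hk
          exact Finset.mem_range.2 (Nat.lt_succ_of_le (hmax i hi))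
      _ = (t m).card := by rw [Finset.card_range, htc]
      _ ≤ _ := Finset.card_le_card (Finset.subset_biUnion_of_mem t hm)
  obtain ⟨f, hf, hft⟩ := (Finset.all_card_le_biUnion_card_iff_exists_injective t).1 hall
  exact ⟨f, hf, fun i => ht i (hft i)⟩

/-! ### Behaviour near the bottom and countability -/

theorem infinite_inter_Iio_of_accumulates {L : Type*} [LinearOrder L] [OrderBot L] {s : Set L}
    (hs : ∀ x, ⊥ < x → ∃ y ∈ s, ⊥ < y ∧ y < x) {x : L} (hx : ⊥ < x) :
    {y | y ∈ s ∧ ⊥ < y ∧ y < x}.Infinite := by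
  intro hfin
  obtain ⟨y, hy, hy0, hyx⟩ := hs x hx
  obtain ⟨m, hm, hmin⟩ := hfin.exists_minimal ⟨y, hy, hy0, hyx⟩
  obtain ⟨z, hz, hz0, hzm⟩ := hs m hm.2.1
  exact hzm.not_ge (hmin ⟨hz, hz0, hzm.trans hm.2.2⟩ hzm.le)

theorem BotNonIsolated.exists_between {L : Type*} [LinearOrder L] [OrderBot L]
    (h0 : BotNonIsolated L) {x : L} (hx : ⊥ < x) : ∃ y, ⊥ < y ∧ y < x := by
  let _ : TopologicalSpace L := Preorder.topology L
  have : OrderTopology L := ⟨rfl⟩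
  have : (nhdsWithin (⊥ : L) {⊥}ᶜ).NeBot := h0
  have h : Set.Iio x ∩ {⊥}ᶜ ∈ nhdsWithin (⊥ : L) {⊥}ᶜ :=
    Filter.inter_mem (mem_nhdsWithin_of_mem_nhds (Iio_mem_nhds hx)) self_mem_nhdsWithin
  obtain ⟨y, hy, hy'⟩ := Filter.nonempty_of_mem h
  exact ⟨y, bot_lt_iff_ne_bot.2 hy', hy⟩

theorem BotNonIsolated.bot_notMem_jumpSet {L : Type*} [LinearOrder L] [OrderBot L]
    (h0 : BotNonIsolated L) : (⊥ : L) ∉ jumpSet L := by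
  rintro ⟨y, hy⟩
  obtain ⟨z, hz, hzy⟩ := h0.exists_between hy.1
  exact hy.2 hz hzy

theorem BotNonIsolated.bot_lt_top {L : Type*} [LinearOrder L] [BoundedOrder L]
    (h0 : BotNonIsolated L) : (⊥ : L) < ⊤ := by
  let _ : TopologicalSpace L := Preorder.topology L
  have : (nhdsWithin (⊥ : L) {⊥}ᶜ).NeBot := h0
  obtain ⟨y, hy⟩ := Filter.nonempty_of_mem
    (self_mem_nhdsWithin : ({⊥}ᶜ : Set L) ∈ nhdsWithin (⊥ : L) {⊥}ᶜ)
  exact (bot_lt_iff_ne_bot.2 hy).trans_le le_top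

theorem RealEmbeddable.countable_jumpSet {L : Type*} [LinearOrder L] (hL : RealEmbeddable L) :
    (jumpSet L).Countable := by
  obtain ⟨e⟩ := hL
  have h : ∀ x : jumpSet L, ∃ y : L, (x : L) ⋖ y := fun x => x.2
  choose s hs using h
  choose r hr hr' using fun x : jumpSet L => exists_rat_btwn (e.lt_iff_lt.2 (hs x).1)
  have hle : ∀ x y : jumpSet L, r x = r y → (x : L) ≤ y := by
    intro x y hxy
    by_contra! hlt
    have h1 : e (s y) ≤ e x := e.le_iff_le.2 ((hs y).ge_of_gt hlt)
    have h2 := hr x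
    have h3 := hr' y
    rw [hxy] at h2
    linarith
  have hinj : Function.Injective r := fun x y hxy =>
    Subtype.ext (le_antisymm (hle x y hxy) (hle y x hxy.symm))
  exact Set.countable_coe_iff.1 hinj.countable

theorem RealEmbeddable.exists_countable_dense {L : Type*} [LinearOrder L]
    (hL : RealEmbeddable L) :
    ∃ S : Set L, S.Countable ∧ ∀ x y : L, x < y → ¬ x ⋖ y → ∃ s ∈ S, x < s ∧ s < y := by
  classical
  obtain ⟨e⟩ := hL
  -- The image of `e` need not contain rationals, so one point is kept for each rational interval
  -- that meets it.
  let I := {r : ℚ × ℚ // ∃ z : L, (r.1 : ℝ) < e z ∧ e z < r.2}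
  choose s hs hs' using fun r : I => r.2
  refine ⟨Set.range s, Set.countable_range s, fun x y hxy hn => ?_⟩
  obtain ⟨z, hz, hzy⟩ := (not_covBy_iff hxy).1 hn
  obtain ⟨a, ha, ha'⟩ := exists_rat_btwn (e.lt_iff_lt.2 hz)
  obtain ⟨b, hb, hb'⟩ := exists_rat_btwn (e.lt_iff_lt.2 hzy)
  let r : I := ⟨(a, b), z, ha', hb⟩
  exact ⟨s r, ⟨r, rfl⟩, e.lt_iff_lt.1 (ha.trans (hs r)), e.lt_iff_lt.1 ((hs' r).trans hb')⟩

/-! ### Maximal chains from birth times -/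

/-- A set all of whose components are endless dense is a copy of `𝔹 n`. -/
theorem mem_copies_of_endlessDense {n : ℕ} {A : Set (DisjointRationals n)}
    (hA : ∀ i, EndlessDense {q : ℚ | (⟨i, q⟩ : DisjointRationals n) ∈ A}) :
    A ∈ copies (DisjointRationals n) := by
  have h := fun i => (hA i).nonempty_orderIso_rat (Set.to_countable _)
  let φ := fun i => (h i).some
  refine ⟨{ toFun := fun d => ⟨d.1.1, φ d.1.1 ⟨d.1.2, d.2⟩⟩
            invFun := fun d => ⟨⟨d.1, ((φ d.1).symm d.2).1⟩, ((φ d.1).symm d.2).2⟩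
            left_inv := ?_
            right_inv := ?_
            map_rel_iff' := ?_ }⟩
  · rintro ⟨⟨i, q⟩, hq⟩
    simp
  · rintro ⟨i, q⟩
    simp
  · rintro ⟨⟨i, q⟩, hq⟩ ⟨⟨j, r⟩, hr⟩
    by_cases hij : i = j
    · subst hij
      simp [Sigma.mk_le_mk_iff]
    · simp [Sigma.le_def, hij]

theorem exists_lt_of_mem_copies {n : ℕ} {A : Set (DisjointRationals n)}
    (hA : A ∈ copies (DisjointRationals n)) {i : Fin n} {q : ℚ}
    (hq : (⟨i, q⟩ : DisjointRationals n) ∈ A) :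
    ∃ r, (⟨i, r⟩ : DisjointRationals n) ∈ A ∧ q < r := by
  obtain ⟨e⟩ := hA
  let a : A := ⟨⟨i, q⟩, hq⟩
  have hlt : e a < ⟨(e a).1, (e a).2 + 1⟩ := Sigma.mk_lt_mk_iff.2 (lt_add_one _)
  have h : a < e.symm ⟨(e a).1, (e a).2 + 1⟩ := e.lt_symm_apply.2 hlt
  obtain ⟨⟨⟨j, r⟩, hb⟩, hbe⟩ : ∃ b : A, b = e.symm ⟨(e a).1, (e a).2 + 1⟩ := ⟨_, rfl⟩
  rw [← hbe] at h
  have h' : (⟨i, q⟩ : DisjointRationals n) < ⟨j, r⟩ := h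
  obtain ⟨hij, hqr⟩ := Sigma.lt_def.1 h'
  dsimp only at hij
  subst hij
  exact ⟨r, hb, hqr⟩

/-- The sublevel sets of a suitable map `𝔹 n → L` form a maximal chain isomorphic to `L`. -/
theorem exists_isMaxChain_of_sublevel {n : ℕ} {L : Type*} [CompleteLinearOrder L]
    (f : DisjointRationals n → L)
    (hdense : ∀ x, ⊥ < x → ∀ i, EndlessDense {q : ℚ | f ⟨i, q⟩ < x})
    (hmeet : ∀ x y, x < y → ∃ d, x ≤ f d ∧ f d < y)
    (hpoint : ∀ i q, (f ⟨i, q⟩ ∈ jumpSet L ∧ ∀ d, f d = f ⟨i, q⟩ → d = ⟨i, q⟩) ∨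
      ∀ r, f ⟨i, r⟩ ≤ f ⟨i, q⟩ → r ≤ q) :
    ∃ 𝓛 : Set (CopiesPoset (DisjointRationals n)),
      IsMaxChain (· ≤ ·) 𝓛 ∧ Nonempty (L ≃o 𝓛) := by
  let A : L → Set (DisjointRationals n) := fun x => {d | f d < x}
  have hA : ∀ x, A x ∈ copies (DisjointRationals n) ∪ {∅} := by
    intro x
    rcases (bot_le (a := x)).eq_or_lt with rfl | hx
    · right
      simp [A]
    · exact Or.inl (mem_copies_of_endlessDense (hdense x hx))
  have hAmono : Monotone A := fun x y hxy d (hd : f d < x) => hd.trans_le hxy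
  let F : L → CopiesPoset (DisjointRationals n) := fun x => ⟨A x, hA x⟩
  have hF : StrictMono F := by
    intro x y hxy
    refine lt_of_le_not_ge (hAmono hxy.le) fun hle => ?_
    obtain ⟨d, hd, hd'⟩ := hmeet x y hxy
    exact (show f d < x from hle hd').not_ge hd
  have hchain : IsChain (· ≤ ·) (Set.range F) := hF.monotone.isChain_range
  refine ⟨Set.range F, ⟨hchain, fun t ht hsub => hsub.antisymm ?_⟩, ⟨hF.orderIso F⟩⟩
  rintro ⟨C, hC⟩ hCt
  have hcomp : ∀ x, C ⊆ A x ∨ A x ⊆ C := fun x => ht.total hCt (hsub ⟨x, rfl⟩)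
  suffices ∃ x, A x = C by
    obtain ⟨x, hx⟩ := this
    exact ⟨x, Subtype.ext hx⟩
  -- `C` is squeezed between `{f < x}` and `{f ≤ x}`; only points born exactly at `x` remain to be
  -- decided.
  set x := sSup {y | A y ⊆ C} with hx
  have hlow : A x ⊆ C := by
    intro d (hd : f d < x)
    obtain ⟨z, hz, hdz⟩ := lt_sSup_iff.1 hd
    exact hz hdz
  have hup : ∀ d ∈ C, f d ≤ x := by
    intro d hd
    by_contra! hlt
    rcases hcomp (f d) with h | h
    · exact lt_irrefl _ (show f d < f d from h hd)
    · exact (le_sSup (show f d ∈ {y | A y ⊆ C} from h)).not_gt hlt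
  by_cases hCx : C ⊆ A x
  · exact ⟨x, hlow.antisymm hCx⟩
  obtain ⟨⟨i, q⟩, hd, hdx⟩ := Set.not_subset.1 hCx
  have hfd : f ⟨i, q⟩ = x := (hup _ hd).antisymm (not_lt.1 hdx)
  have hcopy : C ∈ copies (DisjointRationals n) :=
    hC.resolve_right fun h => by rw [h] at hd; exact hd
  rcases hpoint i q with ⟨⟨y, hy⟩, huniq⟩ | hmax
  · refine ⟨y, Set.Subset.antisymm (fun d (hdy : f d < y) => ?_) fun d hdC => ?_⟩
    · have hdq : f d ≤ f ⟨i, q⟩ := not_lt.1 fun hlt => hy.2 hlt hdy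
      rcases hdq.lt_or_eq with h | h
      · exact hlow (h.trans_eq hfd)
      · rwa [huniq d h]
    · exact ((hup d hdC).trans hfd.ge).trans_lt hy.1
  · obtain ⟨r, hr, hqr⟩ := exists_lt_of_mem_copies hcopy hd
    exact absurd (hmax r ((hup _ hr).trans hfd.ge)) hqr.not_ge

/-- A maximal chain from a family of points `P`, common to all the components and born in
increasing order, and a placement `g` of the jumps of `L`. -/
theorem exists_isMaxChain_of_placement {n : ℕ} (hn : 1 ≤ n) {L M : Type*} [CompleteLinearOrder L]
    [LinearOrder M] [Countable M] (hlt : (⊥ : L) < ⊤) {h : M → L} (hmono : Monotone h)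
    {P : Set M} (hinj : ∀ p ∈ P, ∀ m, h m ≤ h p → m ≤ p) (hPJ : ∀ p ∈ P, h p ∉ jumpSet L)
    (hPtop : ∀ p ∈ P, h p < ⊤)
    (hPmeet : ∀ x y, x < y → (∀ j, x ≤ j → j < y → j ∉ jumpSet L) → ∃ p ∈ P, x ≤ h p ∧ h p < y)
    {g : jumpSet L → Fin n × M} (hg : Function.Injective g) (hgP : ∀ j, (g j).2 ∉ P)
    (hgj : ∀ j, h (g j).2 < j)
    (hdense : ∀ x, ⊥ < x → ∀ i,
      EndlessDense {m | (m ∈ P ∧ h m < x) ∨ ∃ j : jumpSet L, g j = (i, m) ∧ (j : L) < x}) :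
    ∃ 𝓛 : Set (CopiesPoset (DisjointRationals n)),
      IsMaxChain (· ≤ ·) 𝓛 ∧ Nonempty (L ≃o 𝓛) := by
  let X : Fin n → Set M := fun i => {m | m ∈ P ∨ ∃ j, g j = (i, m)}
  let F : Fin n × M → L := Function.extend g Subtype.val (fun d => h d.2)
  have hFg : ∀ j, F (g j) = j := fun j => hg.extend_apply _ _ j
  have hFP : ∀ i, ∀ p ∈ P, F (i, p) = h p := fun i p hp =>
    Function.extend_apply' _ _ _ fun ⟨j, hj⟩ => hgP j (by rw [hj]; exact hp)
  have hset : ∀ i x, {m | (m ∈ P ∧ h m < x) ∨ ∃ j : jumpSet L, g j = (i, m) ∧ (j : L) < x} =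
      {m | m ∈ X i ∧ F (i, m) < x} := by
    intro i x
    ext m
    constructor
    · rintro (⟨hm, hx⟩ | ⟨j, hj, hx⟩)
      · exact ⟨Or.inl hm, by rwa [hFP i m hm]⟩
      · exact ⟨Or.inr ⟨j, hj⟩, by rwa [← hj, hFg]⟩
    · rintro ⟨hm | ⟨j, hj⟩, hx⟩
      · exact Or.inl ⟨hm, by rwa [hFP i m hm] at hx⟩
      · exact Or.inr ⟨j, hj, by rwa [← hj, hFg] at hx⟩
  have hXtop : ∀ i, X i = {m | m ∈ X i ∧ F (i, m) < ⊤} := by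
    intro i
    refine (Set.sep_eq_self_iff_mem_true.2 ?_).symm
    rintro m (hm | ⟨j, hj⟩)
    · rw [hFP i m hm]
      exact hPtop m hm
    · rw [← hj, hFg]
      obtain ⟨y, hy⟩ := j.2
      exact hy.1.trans_le le_top
  have hX : ∀ i, Nonempty (X i ≃o ℚ) := fun i => by
    refine EndlessDense.nonempty_orderIso_rat ?_ (Set.to_countable _)
    rw [hXtop, ← hset]
    exact hdense ⊤ hlt i
  let e : ∀ i, ℚ ≃o X i := fun i => (hX i).some.symm
  refine exists_isMaxChain_of_sublevel (fun d => F (d.1, (e d.1 d.2 : M))) ?_ ?_ ?_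
  · intro x hx i
    have h1 := hdense x hx i
    rw [hset] at h1
    have h2 := h1.preimage_orderIso (e i) (fun m hm => hm.1)
    convert h2 using 1
    ext q
    exact ⟨fun hq => ⟨(e i q).2, hq⟩, fun hq => hq.2⟩
  · intro x y hxy
    by_cases hJ : ∃ j, x ≤ j ∧ j < y ∧ j ∈ jumpSet L
    · obtain ⟨j, hxj, hjy, hj⟩ := hJ
      obtain ⟨⟨i, m⟩, hgm⟩ : ∃ d, g ⟨j, hj⟩ = d := ⟨_, rfl⟩
      refine ⟨⟨i, (e i).symm ⟨m, Or.inr ⟨_, hgm⟩⟩⟩, ?_⟩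
      simp only [OrderIso.apply_symm_apply, ← hgm, hFg]
      exact ⟨hxj, hjy⟩
    · push Not at hJ
      obtain ⟨p, hp, hxp, hpy⟩ := hPmeet x y hxy hJ
      refine ⟨⟨⟨0, hn⟩, (e ⟨0, hn⟩).symm ⟨p, Or.inl hp⟩⟩, ?_⟩
      simp only [OrderIso.apply_symm_apply, hFP _ p hp]
      exact ⟨hxp, hpy⟩
  · intro i q
    rcases (e i q).2 with hq | ⟨j, hj⟩
    · right
      intro r hr
      dsimp only at hr
      rw [hFP i _ hq] at hr
      refine (e i).le_iff_le.1 ?_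
      rcases (e i r).2 with hr' | ⟨j, hj⟩
      · rw [hFP i _ hr'] at hr
        exact hinj _ hq _ hr
      · rw [← hj, hFg] at hr
        -- A jump's position has `h`-value below its birth time, so a jump born by `h` of a point of
        -- `P` lies to the left of that point.
        have h1 := hgj j
        rw [hj] at h1
        exact (hmono.reflect_lt (h1.trans_le hr)).le
    · left
      dsimp only
      rw [← hj, hFg]
      refine ⟨j.2, ?_⟩
      rintro ⟨k, r⟩ hd
      dsimp only at hd
      rcases (e k r).2 with hr | ⟨j', hj'⟩
      · rw [hFP k _ hr] at hd
        exact absurd j.2 (hd ▸ hPJ _ hr)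
      · rw [← hj', hFg] at hd
        have := Subtype.ext hd
        subst this
        rw [hj] at hj'
        obtain ⟨rfl, hqr⟩ := Prod.mk.inj hj'
        rw [(e i).injective (Subtype.ext hqr)]

/-! ### Jump-free intervals -/

/-- Two points of a linear order with no jumps between them enclose a point of any set that is
dense away from the jumps. -/
theorem exists_dense_between {L : Type*} [LinearOrder L] {S : Set L}
    (hS : ∀ x y : L, x < y → ¬ x ⋖ y → ∃ s ∈ S, x < s ∧ s < y) {a b x y : L}
    (hab : ∀ j, a ≤ j → j < b → j ∉ jumpSet L) (hax : a ≤ x) (hxy : x < y) (hyb : y ≤ b) :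
    ∃ s ∈ S, x < s ∧ s < y :=
  hS x y hxy fun h => hab x hax (hxy.trans_le hyb) ⟨y, h⟩

/-- The points of `S` that are interior to an interval without jumps. -/
def jumpFreePart {L : Type*} [LinearOrder L] (S : Set L) : Set L :=
  {p | p ∈ S ∧ ∃ a b, a < p ∧ p < b ∧ ∀ j, a ≤ j → j < b → j ∉ jumpSet L}

section JumpFree

variable {L : Type*} [LinearOrder L] {S : Set L}

theorem jumpFreePart_meets
    (hS : ∀ x y : L, x < y → ¬ x ⋖ y → ∃ s ∈ S, x < s ∧ s < y) {x y : L} (hxy : x < y)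
    (hJ : ∀ j, x ≤ j → j < y → j ∉ jumpSet L) : ∃ p ∈ jumpFreePart S, x < p ∧ p < y := by
  obtain ⟨s, hs, h1, h2⟩ := exists_dense_between hS hJ le_rfl hxy le_rfl
  exact ⟨s, ⟨hs, x, y, h1, h2, hJ⟩, h1, h2⟩

theorem jumpFreePart_exists_between_right
    (hS : ∀ x y : L, x < y → ¬ x ⋖ y → ∃ s ∈ S, x < s ∧ s < y) {p y : L}
    (hp : p ∈ jumpFreePart S) (hy : p < y) : ∃ q ∈ jumpFreePart S, p < q ∧ q < y := by
  obtain ⟨-, a, b, ha, hb, hJ⟩ := hp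
  obtain ⟨q, hq, h1, h2⟩ := jumpFreePart_meets hS (lt_min hy hb) fun j hj hj' =>
    hJ j (ha.le.trans hj) (hj'.trans_le (min_le_right _ _))
  exact ⟨q, hq, h1, h2.trans_le (min_le_left _ _)⟩

theorem jumpFreePart_exists_lt
    (hS : ∀ x y : L, x < y → ¬ x ⋖ y → ∃ s ∈ S, x < s ∧ s < y) {p : L}
    (hp : p ∈ jumpFreePart S) : ∃ q ∈ jumpFreePart S, q < p := by
  obtain ⟨-, a, b, ha, hb, hJ⟩ := hp
  obtain ⟨q, hq, -, h2⟩ := jumpFreePart_meets hS ha fun j hj hj' => hJ j hj (hj'.trans hb)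
  exact ⟨q, hq, h2⟩

theorem notMem_jumpSet_of_mem_jumpFreePart {p : L} (hp : p ∈ jumpFreePart S) :
    p ∉ jumpSet L := by
  obtain ⟨-, a, b, ha, hb, hJ⟩ := hp
  exact hJ p ha.le hb

end JumpFree

/-! ### The two placements -/

section Construction

variable {L : Type*} [CompleteLinearOrder L] {S : Set L}

theorem bot_lt_of_mem_jumpFreePart {p : L} (hp : p ∈ jumpFreePart S) : ⊥ < p := by
  obtain ⟨-, a, b, ha, -⟩ := hp
  exact bot_le.trans_lt ha

theorem lt_top_of_mem_jumpFreePart {p : L} (hp : p ∈ jumpFreePart S) : p < ⊤ := by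
  obtain ⟨-, a, b, -, hb, -⟩ := hp
  exact hb.trans_le le_top

/-- The jump-free points serve as positions. A dense subset `P` of them keeps every component
endless dense; the jumps take leftover positions below themselves, all in component `0`. -/
theorem exists_isMaxChain_of_jumpFreePart_accumulates {n : ℕ} (hn : 1 ≤ n)
    (hlt : (⊥ : L) < ⊤) (hbot : (⊥ : L) ∉ jumpSet L) (hJc : (jumpSet L).Countable)
    (hSc : S.Countable) (hS : ∀ x y : L, x < y → ¬ x ⋖ y → ∃ s ∈ S, x < s ∧ s < y)
    (hacc : ∀ x : L, ⊥ < x → ∃ t ∈ jumpFreePart S, t < x) :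
    ∃ 𝓛 : Set (CopiesPoset (DisjointRationals n)),
      IsMaxChain (· ≤ ·) 𝓛 ∧ Nonempty (L ≃o 𝓛) := by
  let T := jumpFreePart S
  have : Countable (jumpSet L) := hJc.to_subtype
  have : Countable T := (hSc.mono fun p hp => hp.1).to_subtype
  have : DenselyOrdered T := ⟨fun a b hab => by
    obtain ⟨c, hc, h1, h2⟩ := jumpFreePart_exists_between_right hS a.2 hab
    exact ⟨⟨c, hc⟩, h1, h2⟩⟩
  let I := {d : T × T // d.1 < d.2}
  let A : I ⊕ jumpSet L → Set T :=
    Sum.elim (fun d => Set.Ioo d.1.1 d.1.2) fun j => {t | (t : L) < j}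
  have hA : ∀ i, (A i).Infinite := by
    rintro (d | j)
    · exact Set.Ioo_infinite d.2
    · have hj : (⊥ : L) < j := bot_lt_iff_ne_bot.2 fun h => hbot (h ▸ j.2)
      have h := infinite_inter_Iio_of_accumulates (s := T) (fun x hx => by
        obtain ⟨t, ht, htx⟩ := hacc x hx
        exact ⟨t, ht, bot_lt_of_mem_jumpFreePart ht, htx⟩) hj
      refine Set.Infinite.of_image Subtype.val (h.mono ?_)
      rintro t ⟨ht, -, htj⟩
      exact ⟨⟨t, ht⟩, htj, rfl⟩
  obtain ⟨c, hc, hcA⟩ := exists_injective_choice A hA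
  let P : Set T := Set.range (c ∘ Sum.inl)
  have hP : ∀ a b : T, a < b → ∃ p ∈ P, a < p ∧ p < b := fun a b hab =>
    ⟨_, ⟨⟨(a, b), hab⟩, rfl⟩, hcA (Sum.inl ⟨(a, b), hab⟩)⟩
  have hcj : ∀ j : jumpSet L, (c (Sum.inr j) : L) < j := fun j => hcA (Sum.inr j)
  refine exists_isMaxChain_of_placement hn hlt (M := T) (h := Subtype.val) (P := P)
    (g := fun j => (⟨0, hn⟩, c (Sum.inr j))) (Subtype.mono_coe _) (fun p _ m h => h)
    (fun p _ => notMem_jumpSet_of_mem_jumpFreePart p.2)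
    (fun p _ => lt_top_of_mem_jumpFreePart p.2) ?_ ?_ ?_ hcj ?_
  · intro x y hxy hJ
    obtain ⟨t, ht, hxt, hty⟩ := jumpFreePart_meets hS hxy hJ
    obtain ⟨u, hu, htu, huy⟩ := jumpFreePart_exists_between_right hS ht hty
    obtain ⟨p, hp, h1, h2⟩ := hP ⟨t, ht⟩ ⟨u, hu⟩ htu
    exact ⟨p, hp, (hxt.trans h1).le, lt_trans h2 huy⟩
  · intro j k hjk
    exact Sum.inr_injective (hc (Prod.mk.inj hjk).2)
  · rintro j ⟨d, hd⟩
    exact Sum.inl_ne_inr (hc hd)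
  · intro x hx i
    have hlt_x : ∀ m : T, (m ∈ P ∧ (m : L) < x ∨
        ∃ j : jumpSet L, ((⟨0, hn⟩ : Fin n), c (Sum.inr j)) = (i, m) ∧ (j : L) < x) →
        (m : L) < x := by
      rintro m (⟨-, h⟩ | ⟨j, hj, h⟩)
      · exact h
      · rw [← (Prod.mk.inj hj).2]
        exact (hcj j).trans h
    have hbelow : ∀ m : T, ∃ k : T, k < m := fun m => by
      obtain ⟨k, hk, h⟩ := jumpFreePart_exists_lt hS m.2
      exact ⟨⟨k, hk⟩, h⟩
    refine ⟨?_, fun m hm => ?_, fun m hm => ?_, fun m hm k hk hmk => ?_⟩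
    · obtain ⟨t, ht, htx⟩ := hacc x hx
      obtain ⟨k, hk⟩ := hbelow ⟨t, ht⟩
      obtain ⟨p, hp, -, h2⟩ := hP _ _ hk
      exact ⟨p, Or.inl ⟨hp, lt_trans h2 htx⟩⟩
    · obtain ⟨u, hu, hmu, hux⟩ := jumpFreePart_exists_between_right hS m.2 (hlt_x m hm)
      obtain ⟨p, hp, h1, h2⟩ := hP m ⟨u, hu⟩ hmu
      exact ⟨p, Or.inl ⟨hp, lt_trans h2 hux⟩, h1⟩
    · obtain ⟨k, hk⟩ := hbelow m
      obtain ⟨p, hp, -, h2⟩ := hP _ _ hk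
      exact ⟨p, Or.inl ⟨hp, lt_trans h2 (hlt_x m hm)⟩, h2⟩
    · obtain ⟨p, hp, h1, h2⟩ := hP _ _ hmk
      exact ⟨p, Or.inl ⟨hp, lt_trans h2 (hlt_x k hk)⟩, h1, h2⟩

/-- Here the jumps must supply density in every component at arbitrarily early times. They fill part
of a copy of `ℚ` put to the left of all jump-free points. -/
theorem exists_isMaxChain_of_jumpSet_accumulates {n : ℕ} (hn : 1 ≤ n)
    (hlt : (⊥ : L) < ⊤) (hbot : (⊥ : L) ∉ jumpSet L) (hJc : (jumpSet L).Countable)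
    (hSc : S.Countable) (hS : ∀ x y : L, x < y → ¬ x ⋖ y → ∃ s ∈ S, x < s ∧ s < y)
    (hS0 : ∀ x : L, ⊥ < x → ∃ s ∈ S, ⊥ < s ∧ s < x)
    (hacc : ∀ x : L, ⊥ < x → ∃ j ∈ jumpSet L, ⊥ < j ∧ j < x) :
    ∃ 𝓛 : Set (CopiesPoset (DisjointRationals n)),
      IsMaxChain (· ≤ ·) 𝓛 ∧ Nonempty (L ≃o 𝓛) := by
  classical
  let T := jumpFreePart S
  have : Countable (jumpSet L) := hJc.to_subtype
  have : Countable T := (hSc.mono fun p hp => hp.1).to_subtype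
  have : Countable S := hSc.to_subtype
  -- An entry `(i, a, b, s)` demands a jump below `s` placed in `(a, b)` in the component `i`.
  let R := {r : Fin n × (ℚ × ℚ) × S // r.2.1.1 < r.2.1.2 ∧ ⊥ < (r.2.2 : L)}
  obtain ⟨c, hc, hcA⟩ := exists_injective_choice
    (fun r : R => {j : jumpSet L | (j : L) < r.1.2.2}) fun r => by
      refine Set.Infinite.of_image Subtype.val
        ((infinite_inter_Iio_of_accumulates hacc r.2.2).mono ?_)
      rintro j ⟨hj, -, hjs⟩
      exact ⟨⟨j, hj⟩, hjs, rfl⟩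
  -- A jump chosen for a demand must meet it; any other jump may go anywhere.
  let B : jumpSet L → Set (Fin n × ℚ) :=
    Function.extend c (fun r => (fun q => (r.1.1, q)) '' Set.Ioo r.1.2.1.1 r.1.2.1.2)
      fun _ => Set.univ
  obtain ⟨d, hd, hdB⟩ := exists_injective_choice B fun j => by
    by_cases hj : ∃ r, c r = j
    · obtain ⟨r, rfl⟩ := hj
      simp only [B, hc.extend_apply]
      exact (Set.Ioo_infinite r.2.1).image (Prod.mk_right_injective _).injOn
    · simp only [B, Function.extend_apply' _ _ _ hj]
      have : Nonempty (Fin n) := ⟨⟨0, hn⟩⟩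
      exact Set.infinite_univ
  have hreq : ∀ (i : Fin n) (a b : ℚ) (x : L), a < b → ⊥ < x →
      ∃ q, a < q ∧ q < b ∧ ∃ j : jumpSet L, d j = (i, q) ∧ (j : L) < x := by
    intro i a b x hab hx
    obtain ⟨s, hs, hs0, hsx⟩ := hS0 x hx
    let r : R := ⟨(i, (a, b), ⟨s, hs⟩), hab, hs0⟩
    have h := hdB (c r)
    simp only [B, hc.extend_apply] at h
    obtain ⟨q, ⟨haq, hqb⟩, hq⟩ := h
    exact ⟨q, haq, hqb, c r, hq.symm, lt_trans (hcA r) hsx⟩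
  let ι : ℚ → Lex (ℚ ⊕ T) := fun q => Sum.inlₗ q
  let κ : T → Lex (ℚ ⊕ T) := fun t => Sum.inrₗ t
  let h : Lex (ℚ ⊕ T) → L := fun m => Sum.elim (fun _ => ⊥) Subtype.val (ofLex m)
  have : Countable (Lex (ℚ ⊕ T)) := inferInstanceAs (Countable (ℚ ⊕ T))
  have hj0 : ∀ j : jumpSet L, (⊥ : L) < j := fun j =>
    bot_lt_iff_ne_bot.2 fun h => hbot (h ▸ j.2)
  have hcases : ∀ m : Lex (ℚ ⊕ T), (∃ q, m = ι q) ∨ ∃ t, m = κ t := by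
    intro m
    rcases hm : ofLex m with q | t
    · exact Or.inl ⟨q, congrArg toLex hm⟩
    · exact Or.inr ⟨t, congrArg toLex hm⟩
  have hιι : ∀ {a b}, ι a < ι b ↔ a < b := Sum.Lex.inl_lt_inl_iff
  have hκκ : ∀ {a b}, κ a < κ b ↔ a < b := Sum.Lex.inr_lt_inr_iff
  have hικ : ∀ a b, ι a < κ b := Sum.Lex.inl_lt_inr
  have hκι : ∀ a b, ¬ κ b < ι a := fun a b => (hικ a b).not_gt
  have hhκ : ∀ t, h (κ t) = t := fun t => rfl
  have hhι : ∀ q, h (ι q) = ⊥ := fun q => rfl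
  have hικne : ∀ q t, ι q ≠ κ t := fun q t => (hικ q t).ne
  have hmono : Monotone h := by
    intro a b hab
    rcases hcases a with ⟨q, rfl⟩ | ⟨t, rfl⟩
    · exact bot_le
    rcases hcases b with ⟨q, rfl⟩ | ⟨u, rfl⟩
    · exact absurd hab (hικ q t).not_ge
    · exact not_lt.1 fun hlt => hab.not_gt (hκκ.2 hlt)
  refine exists_isMaxChain_of_placement hn hlt hmono (P := Set.range κ)
    (g := fun j => ((d j).1, ι (d j).2)) ?_ ?_ ?_ ?_ ?_ ?_ ?_ ?_
  · rintro _ ⟨t, rfl⟩ m hm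
    rcases hcases m with ⟨q, rfl⟩ | ⟨u, rfl⟩
    · exact (hικ q t).le
    · exact not_lt.1 fun hlt => hm.not_gt (hκκ.1 hlt)
  · rintro _ ⟨t, rfl⟩
    exact notMem_jumpSet_of_mem_jumpFreePart t.2
  · rintro _ ⟨t, rfl⟩
    exact lt_top_of_mem_jumpFreePart t.2
  · intro x y hxy hJ
    obtain ⟨t, ht, hxt, hty⟩ := jumpFreePart_meets hS hxy hJ
    exact ⟨_, ⟨⟨t, ht⟩, rfl⟩, hxt.le, hty⟩
  · intro j k hjk
    obtain ⟨h1, h2⟩ := Prod.mk.inj hjk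
    exact hd (Prod.ext h1 (Sum.inl_injective (toLex.injective h2)))
  · rintro j ⟨t, ht⟩
    exact hικne _ _ ht.symm
  · exact hj0
  · intro x hx i
    have hmem : ∀ a b : ℚ, a < b →
        ∃ q, a < q ∧ q < b ∧ ∃ j : jumpSet L, ((d j).1, ι (d j).2) = (i, ι q) ∧ (j : L) < x := by
      intro a b hab
      obtain ⟨q, haq, hqb, j, hj, hjx⟩ := hreq i a b x hab hx
      exact ⟨q, haq, hqb, j, by rw [hj], hjx⟩
    have hκlt : ∀ t : T, (κ t ∈ Set.range κ ∧ h (κ t) < x ∨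
        ∃ j : jumpSet L, ((d j).1, ι (d j).2) = (i, κ t) ∧ (j : L) < x) → (t : L) < x := by
      rintro t (⟨-, h⟩ | ⟨j, hj, -⟩)
      · exact h
      · exact absurd (Prod.mk.inj hj).2 (hικne _ _)
    refine ⟨?_, fun m hm => ?_, fun m hm => ?_, fun m hm k hk hmk => ?_⟩
    · obtain ⟨q, -, -, hq⟩ := hmem 0 1 one_pos
      exact ⟨ι q, Or.inr hq⟩
    · rcases hcases m with ⟨q, rfl⟩ | ⟨t, rfl⟩
      · obtain ⟨r, hqr, -, hr⟩ := hmem q (q + 1) (lt_add_one q)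
        exact ⟨ι r, Or.inr hr, hιι.2 hqr⟩
      · obtain ⟨u, hu, htu, hux⟩ := jumpFreePart_exists_between_right hS t.2 (hκlt t hm)
        exact ⟨κ ⟨u, hu⟩, Or.inl ⟨⟨_, rfl⟩, hux⟩, hκκ.2 htu⟩
    · rcases hcases m with ⟨q, rfl⟩ | ⟨t, rfl⟩
      · obtain ⟨r, -, hrq, hr⟩ := hmem (q - 1) q (sub_one_lt q)
        exact ⟨ι r, Or.inr hr, hιι.2 hrq⟩
      · obtain ⟨q, -, -, hq⟩ := hmem 0 1 one_pos
        exact ⟨ι q, Or.inr hq, hικ _ _⟩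
    · rcases hcases m with ⟨q, rfl⟩ | ⟨t, rfl⟩
      · rcases hcases k with ⟨q', rfl⟩ | ⟨u, rfl⟩
        · obtain ⟨r, hqr, hrq, hr⟩ := hmem q q' (hιι.1 hmk)
          exact ⟨ι r, Or.inr hr, hιι.2 hqr, hιι.2 hrq⟩
        · obtain ⟨r, hqr, -, hr⟩ := hmem q (q + 1) (lt_add_one q)
          exact ⟨ι r, Or.inr hr, hιι.2 hqr, hικ _ _⟩
      · rcases hcases k with ⟨q', rfl⟩ | ⟨u, rfl⟩
        · exact absurd hmk (hκι _ _)
        · obtain ⟨v, hv, htv, hvu⟩ := jumpFreePart_exists_between_right hS t.2 (hκκ.1 hmk)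
          exact ⟨κ ⟨v, hv⟩, Or.inl ⟨⟨_, rfl⟩, lt_trans hvu (hκlt u hk)⟩, hκκ.2 htv, hκκ.2 hvu⟩

end Construction

theorem theorem5 (n : ℕ) (hn : 1 ≤ n) (L : Type*) [CompleteLinearOrder L]
    (hL : RealEmbeddable L) (h0 : BotNonIsolated L) :
    ∃ 𝓛 : Set (CopiesPoset (DisjointRationals n)),
      IsMaxChain (· ≤ ·) 𝓛 ∧ Nonempty (L ≃o 𝓛) := by
  have hlt : (⊥ : L) < ⊤ := h0.bot_lt_top
  have hbot := h0.bot_notMem_jumpSet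
  obtain ⟨S, hSc, hS⟩ := hL.exists_countable_dense
  by_cases hacc : ∀ x : L, ⊥ < x → ∃ t ∈ jumpFreePart S, t < x
  · exact exists_isMaxChain_of_jumpFreePart_accumulates hn hlt hbot hL.countable_jumpSet hSc hS
      hacc
  push Not at hacc
  obtain ⟨w, hw, hwT⟩ := hacc
  refine exists_isMaxChain_of_jumpSet_accumulates hn hlt hbot hL.countable_jumpSet hSc hS
    (fun x hx => hS ⊥ x hx fun h => hbot ⟨x, h⟩) fun x hx => ?_
  obtain ⟨z, hz, hzx⟩ := h0.exists_between (lt_min hx hw)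
  -- Without jumps in `(⊥, x)`, the interval `[y, z)` would be jump-free and give a point of
  -- `jumpFreePart S` below `w`.
  obtain ⟨y, hy, hyz⟩ := h0.exists_between hz
  by_contra! hJ
  obtain ⟨p, hp, -, hpz⟩ := jumpFreePart_meets hS hyz fun j hj hjz hjJ =>
    (hJ j hjJ (hy.trans_le hj)).not_gt (hjz.trans (hzx.trans_le (min_le_left _ _)))
  exact (hwT p hp).not_gt (hpz.trans (hzx.trans_le (min_le_right _ _)))
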